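/- **Setting.** Let $X$, $Y$ be (real or complex) Hilbert spaces, $X_0\subseteq X_1\subseteq\dots$ closed subspaces of $X$ with orthogonal projectors $P_N$ onto $X_N$, and $T_N:X_N\to Y$ linear operators with $\|T_N\|\le 1$ and $T_Nx=T_Mx$ for $x\in X_M$, $M\le N$; $T_N^*:Y\to X_N$ is the adjoint. Let $y\in Y$ and suppose that there are $N_*\in\mathbb N_0$ and $x_*\in X_{N_*}$ with $T_{N_*}x_*=y$. Let $\eta>0$, $\tau>1$, $x_{0,0}\in X_0$. **CGNE at level $N$** with initial guess $x_0\in X_N$: $r_0=w_0=y-T_Nx_0$ and, for $k\ge 0$, $d_k=T_N^*w_k$, $\alpha_k=\|T_N^*r_k\|^2/\|T_Nd_k\|^2$, $x_{k+1}=x_k+\alpha_kd_k$, $r_{k+1}=r_k-\alpha_kT_Nd_k$, $\beta_k=\|T_N^*r_{k+1}\|^2/\|T_N^*r_k\|^2$, $w_{k+1}=r_{k+1}+\beta_kw_k$. **Multi-level CGNE algorithm** for data $y^\delta\in Y$ with noise level $\delta\ge0$ (the CGNE iteration is run with $y^\delta$ in place of $y$). Put $\epsilon_N=2(1+\eta)(\delta+\|P_Nx_*-x_*\|)\|y^\delta\|$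 and $\epsilon=2(1+\eta)\tau\delta\|y^\delta\|$. (a) If $\|T_0x_{0,0}-y^\delta\|^2\le\epsilon$, the algorithm terminates with $x_{0,0}$. Otherwise it begins with initial guess $x_{0,0}$ at a level $J$ with $\|T_Jx_{0,0}-y^\delta\|^2>\epsilon_J$, where $J=0$ if this holds for $J=0$. (b) At level $N$, CGNE is performed from the initial guess $x_{0,N}$ until for the first time $\|T_Nx_{k+1,N}-y^\delta\|^2\le\epsilon_N$. For this $k=:k_*(N)$, if $\|T_{N+1}x_{k+1,N}-y^\delta\|^2\le\epsilon$, the algorithm terminates at level $N$ with $x_{k+1,N}$; otherwise it continues at level $N+1$ with $x_{0,N+1}:=x_{k,N}$. **Theorem 2.6.** Consider exact data, $\delta=0$, $y^\delta=y$. Unless the algorithm terminates in (a), a starting level $J$ exists. For every admissible choice of $J$ (any $J\in\mathbb N_0$ if the algorithm terminates in (a)), no CGNE step that is performed involves a vanishing denominator $\|T_N^*r_k\|^2$ or $\|T_Nd_k\|^2$, and the algorithm converges to a solution $\hat x$ of the problem. More precisely, let $\hat N$ be the smallest $N\ge J$ with $P_Nx_*=x_*$ (it exists). Then there are a level $N\le\hat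 N$ and $\hat x\in X_N$ with $T_N\hat x=y$ such that the sequence of the iterates of the algorithm (continued constantly by the final approximation if the algorithm terminates) converges to $\hat x$ in norm, and either 1. the algorithm terminates after finitely many steps, at level $N$, with final approximation $\hat x$; or 2. the algorithm reaches level $N$ after finitely many steps and the CGNE iteration at level $N$ runs forever (and converges to $\hat x$); in this case $N=\hat N$ if $y\ne 0$. -/

import Mathlib

open Filter Topology

/-- A nested family of closed subspaces `V 0 ≤ V 1 ≤ …` of a Hilbert space `X` together with
compatible operators `T N : V N → Y` of norm at most one.  The adjoint of `T N` is taken between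
the Hilbert spaces `V N` and `Y`, so that its range lies in `V N`. -/
structure LevelFamily (𝕜 X Y : Type*) [RCLike 𝕜]
    [NormedAddCommGroup X] [InnerProductSpace 𝕜 X]
    [NormedAddCommGroup Y] [InnerProductSpace 𝕜 Y] where
  /-- the subspaces -/
  V : ℕ → Submodule 𝕜 X
  closed : ∀ N, IsClosed (V N : Set X)
  mono : Monotone V
  /-- the operators -/
  T : ∀ N, V N →L[𝕜] Y
  norm_le : ∀ N, ‖T N‖ ≤ 1
  compat : ∀ (M N : ℕ) (h : M ≤ N) (x : V M), T N (Submodule.inclusion (mono h) x) = T M x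

/-! ### The CGNE iteration for a single operator -/

/-- The variables `x_k`, `r_k`, `w_k` of the CGNE iteration. -/
structure CGState (E Y : Type*) where
  x : E
  r : Y
  w : Y

section CGNE

variable {𝕜 E Y : Type*} [RCLike 𝕜]
  [NormedAddCommGroup E] [InnerProductSpace 𝕜 E] [CompleteSpace E]
  [NormedAddCommGroup Y] [InnerProductSpace 𝕜 Y] [CompleteSpace Y]

/-- The search direction `d_k = T* w_k`. -/
noncomputable def cgDir (T : E →L[𝕜] Y) (s : CGState E Y) : E :=
  ContinuousLinearMap.adjoint T s.w

/-- The normal residual `T* r_k`. -/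
noncomputable def cgGrad (T : E →L[𝕜] Y) (s : CGState E Y) : E :=
  ContinuousLinearMap.adjoint T s.r

/-- The step length `α_k = ‖T* r_k‖² / ‖T d_k‖²`. -/
noncomputable def cgAlpha (T : E →L[𝕜] Y) (s : CGState E Y) : ℝ :=
  ‖cgGrad T s‖ ^ 2 / ‖T (cgDir T s)‖ ^ 2

/-- The new residual `r_{k+1} = r_k - α_k T d_k`. -/
noncomputable def cgResidual (T : E →L[𝕜] Y) (s : CGState E Y) : Y :=
  s.r - (cgAlpha T s : 𝕜) • T (cgDir T s)

/-- `β_k = ‖T* r_{k+1}‖² / ‖T* r_k‖²`. -/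
noncomputable def cgBeta (T : E →L[𝕜] Y) (s : CGState E Y) : ℝ :=
  ‖ContinuousLinearMap.adjoint T (cgResidual T s)‖ ^ 2 / ‖cgGrad T s‖ ^ 2

/-- One step of CGNE. -/
noncomputable def cgStep (T : E →L[𝕜] Y) (s : CGState E Y) : CGState E Y where
  x := s.x + (cgAlpha T s : 𝕜) • cgDir T s
  r := cgResidual T s
  w := cgResidual T s + (cgBeta T s : 𝕜) • s.w

/-- The state of CGNE for `T x = y` after `k` steps from the initial guess `x₀`. -/
noncomputable def cgIter (T : E →L[𝕜] Y) (y : Y) (x₀ : E) (k : ℕ) : CGState E Y :=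
  (cgStep T)^[k] ⟨x₀, y - T x₀, y - T x₀⟩

end CGNE

namespace LevelFamily

variable {𝕜 X Y : Type*} [RCLike 𝕜]
  [NormedAddCommGroup X] [InnerProductSpace 𝕜 X] [CompleteSpace X]
  [NormedAddCommGroup Y] [InnerProductSpace 𝕜 Y] [CompleteSpace Y]

instance instCompleteSpaceLevel (L : LevelFamily 𝕜 X Y) (N : ℕ) : CompleteSpace (L.V N) :=
  (L.closed N).completeSpace_coe

/-- The orthogonal projector `P_N` onto the `N`-th subspace, as a map from `X` to `X`. -/
noncomputable def P (L : LevelFamily 𝕜 X Y) (N : ℕ) : X →L[𝕜] X := (L.V N).starProjection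

/-- An element of a lower level, regarded as an element of a higher level. -/
def incl (L : LevelFamily 𝕜 X Y) {M N : ℕ} (h : M ≤ N) (x : L.V M) : L.V N :=
  Submodule.inclusion (L.mono h) x

end LevelFamily

/-! ### The multi-level algorithm -/

/-- The quantities that enter the multi-level algorithm: the (possibly noisy) data `yδ`, the noise
level `δ`, the parameters `η`, `τ`, and the element `xs` whose distances to the levels enter the
level-wise stopping rule. -/
structure MLParams (X Y : Type*) where
  yδ : Y
  δ : ℝ
  η : ℝ
  τ : ℝ
  xs : X

/-- The status of the multi-level algorithm: `running N x₀ k` means that CGNE is performed at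
level `N`, was started there at `x₀`, and that `k` steps were accepted at this level;
`done N x` means that the algorithm has terminated at level `N` with the approximation `x`. -/
inductive MLStatus {𝕜 X Y : Type*} [RCLike 𝕜]
    [NormedAddCommGroup X] [InnerProductSpace 𝕜 X]
    [NormedAddCommGroup Y] [InnerProductSpace 𝕜 Y] (L : LevelFamily 𝕜 X Y) where
  | running (N : ℕ) (x₀ : L.V N) (k : ℕ) : MLStatus L
  | done (N : ℕ) (x : L.V N) : MLStatus L

namespace MLParams

variable {𝕜 X Y : Type*} [RCLike 𝕜]
  [NormedAddCommGroup X] [InnerProductSpace 𝕜 X] [CompleteSpace X]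
  [NormedAddCommGroup Y] [InnerProductSpace 𝕜 Y] [CompleteSpace Y]

/-- The threshold `2 (1 + η) (δ + ‖P_N x_* - x_*‖) ‖y^δ‖` of the stopping rule at level `N`. -/
noncomputable def levelTol (p : MLParams X Y) (L : LevelFamily 𝕜 X Y) (N : ℕ) : ℝ :=
  2 * (1 + p.η) * (p.δ + ‖L.P N p.xs - p.xs‖) * ‖p.yδ‖

/-- The threshold `2 (1 + η) τ δ ‖y^δ‖` for the termination of the whole algorithm. -/
noncomputable def stopTol (p : MLParams X Y) : ℝ :=
  2 * (1 + p.η) * p.τ * p.δ * ‖p.yδ‖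

/-- The squared residual `‖T_N x - y^δ‖²`. -/
noncomputable def resSq (p : MLParams X Y) (L : LevelFamily 𝕜 X Y) (N : ℕ) (x : L.V N) : ℝ :=
  ‖L.T N x - p.yδ‖ ^ 2

/-- The state of the CGNE iteration at level `N`, started at `x₀`, after `k` steps. -/
noncomputable def cg (p : MLParams X Y) (L : LevelFamily 𝕜 X Y) (N : ℕ) (x₀ : L.V N) (k : ℕ) :
    CGState (L.V N) Y :=
  cgIter (L.T N) p.yδ x₀ k

/-- One step of the multi-level algorithm.  While running at level `N` at `x_{k,N}`, the next CGNE
iterate `x_{k+1,N}` is computed.  If its squared residual exceeds the threshold of the level, then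
it is accepted and the iteration at level `N` goes on.  Otherwise `k` is the termination index of
level `N`: if `x_{k+1,N}` meets the global criterion (tested with `T_{N+1}`), the algorithm
terminates with it, and else level `N + 1` is started at `x_{k,N}`. -/
noncomputable def step (p : MLParams X Y) (L : LevelFamily 𝕜 X Y) : MLStatus L → MLStatus L
  | .done N x => .done N x
  | .running N x₀ k =>
      if p.resSq L N (p.cg L N x₀ (k + 1)).x ≤ p.levelTol L N then
        if p.resSq L (N + 1) (L.incl (Nat.le_succ N) (p.cg L N x₀ (k + 1)).x) ≤ p.stopTol then
          .done N (p.cg L N x₀ (k + 1)).x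
        else
          .running (N + 1) (L.incl (Nat.le_succ N) (p.cg L N x₀ k).x) 0
      else
        .running N x₀ (k + 1)

/-- The levels `J` at which the algorithm may begin with the initial guess `x₀₀ ∈ V 0`: the
squared residual exceeds the threshold of level `J`, and `J` is `0` whenever this choice is
possible. -/
def IsStartLevel (p : MLParams X Y) (L : LevelFamily 𝕜 X Y) (x₀₀ : L.V 0) (J : ℕ) : Prop :=
  p.levelTol L J < p.resSq L J (L.incl (Nat.zero_le J) x₀₀) ∧
    (p.levelTol L 0 < p.resSq L 0 x₀₀ → J = 0)

/-- The initial status: the initial guess is accepted immediately if it meets the global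
criterion; otherwise CGNE is started with it at level `J`. -/
noncomputable def init (p : MLParams X Y) (L : LevelFamily 𝕜 X Y) (x₀₀ : L.V 0) (J : ℕ) :
    MLStatus L :=
  if p.resSq L 0 x₀₀ ≤ p.stopTol then .done 0 x₀₀
  else .running J (L.incl (Nat.zero_le J) x₀₀) 0

/-- The status of the multi-level algorithm after `n` steps. -/
noncomputable def run (p : MLParams X Y) (L : LevelFamily 𝕜 X Y) (x₀₀ : L.V 0) (J n : ℕ) :
    MLStatus L :=
  (p.step L)^[n] (p.init L x₀₀ J)

/-- The current approximation: the iterate `x_{k,N}` while running, the final approximation once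
the algorithm has terminated. -/
noncomputable def current (p : MLParams X Y) (L : LevelFamily 𝕜 X Y) : MLStatus L → X
  | .running N x₀ k => ((p.cg L N x₀ k).x : X)
  | .done _ x => (x : X)

end MLParams

/-! For exact data the global test demands an exact solution. The key estimate
(`norm_sq_le_of_adjoint_eq_zero`) bounds a least-squares residual r at level N by ‖r‖² ≤ ‖P_N x_* -
x_*‖ ‖y‖ = ε_N / (2(1+η)). Hence the normal residual cannot vanish above the threshold. Since the
CGNE residuals converge to such an r, a level with ε_N > 0 is left after finitely many steps. A
level containing x_* has ε_N = 0, and meeting that threshold ends the algorithm, so no later level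
is reached. The run therefore terminates or stays forever at one level, where the equation is
solvable. There the iterates converge in norm: by orthogonality (`cgOrthogonal`), ‖x_m - x_n‖² is at
most the drop of the squared error (`norm_cgIter_x_sub_sq_le`), so they form a Cauchy sequence. -/

set_option linter.unusedSectionVars false

section CGNE

variable {𝕜 E Y : Type*} [RCLike 𝕜]
  [NormedAddCommGroup E] [InnerProductSpace 𝕜 E] [CompleteSpace E]
  [NormedAddCommGroup Y] [InnerProductSpace 𝕜 Y] [CompleteSpace Y]

open ContinuousLinearMap (adjoint)

/-! ### One-step recurrences of CGNE. -/

section Basic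

variable (T : E →L[𝕜] Y) (y : Y) (x₀ : E)

theorem cgIter_succ (k : ℕ) : cgIter T y x₀ (k + 1) = cgStep T (cgIter T y x₀ k) := by
  simp only [cgIter, Function.iterate_succ_apply']

theorem cgIter_r_eq (k : ℕ) : (cgIter T y x₀ k).r = y - T (cgIter T y x₀ k).x := by
  induction k with
  | zero => rfl
  | succ k ih =>
    rw [cgIter_succ]
    simp only [cgStep, cgResidual, map_add, map_smul, ih]
    abel

theorem cgIter_x_succ (k : ℕ) : (cgIter T y x₀ (k + 1)).x = (cgIter T y x₀ k).x +
    (cgAlpha T (cgIter T y x₀ k) : 𝕜) • cgDir T (cgIter T y x₀ k) := by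
  rw [cgIter_succ]; rfl

theorem cgIter_r_succ (k : ℕ) : (cgIter T y x₀ (k + 1)).r = (cgIter T y x₀ k).r -
    (cgAlpha T (cgIter T y x₀ k) : 𝕜) • T (cgDir T (cgIter T y x₀ k)) := by
  rw [cgIter_succ]; rfl

theorem cgIter_w_succ (k : ℕ) : (cgIter T y x₀ (k + 1)).w = (cgIter T y x₀ (k + 1)).r +
    (cgBeta T (cgIter T y x₀ k) : 𝕜) • (cgIter T y x₀ k).w := by
  rw [cgIter_succ]; rfl

theorem cgGrad_succ (k : ℕ) : cgGrad T (cgIter T y x₀ (k + 1)) = cgGrad T (cgIter T y x₀ k) -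
    (cgAlpha T (cgIter T y x₀ k) : 𝕜) • adjoint T (T (cgDir T (cgIter T y x₀ k))) := by
  simp only [cgGrad, cgIter_r_succ, map_sub, map_smul]

theorem cgDir_succ (k : ℕ) : cgDir T (cgIter T y x₀ (k + 1)) = cgGrad T (cgIter T y x₀ (k + 1)) +
    (cgBeta T (cgIter T y x₀ k) : 𝕜) • cgDir T (cgIter T y x₀ k) := by
  simp only [cgGrad, cgDir, cgIter_w_succ, map_add, map_smul]

theorem cgDir_zero : cgDir T (cgIter T y x₀ 0) = cgGrad T (cgIter T y x₀ 0) := rfl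

theorem cgBeta_eq (k : ℕ) : cgBeta T (cgIter T y x₀ k) =
    ‖cgGrad T (cgIter T y x₀ (k + 1))‖ ^ 2 / ‖cgGrad T (cgIter T y x₀ k)‖ ^ 2 := by
  rw [cgIter_succ]; rfl

/-- Once the normal residual vanishes, so does the search direction. -/
theorem cgDir_eq_zero_of_cgGrad_eq_zero {k : ℕ} (h : cgGrad T (cgIter T y x₀ k) = 0) :
    cgDir T (cgIter T y x₀ k) = 0 := by
  cases k with
  | zero => rw [cgDir_zero, h]
  | succ k => simp [cgDir_succ, cgBeta_eq, h]

end Basic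

/-- The orthogonality relations of the CGNE iteration up to index `k`. They do not require the
denominators to be nonzero: once the normal residual vanishes, the iteration is stationary. -/
structure CGOrthogonal (T : E →L[𝕜] Y) (y : Y) (x₀ : E) (k : ℕ) : Prop where
  grad_dir : ∀ i < k, inner 𝕜 (cgGrad T (cgIter T y x₀ k)) (cgDir T (cgIter T y x₀ i)) = 0
  grad_grad : ∀ i < k, inner 𝕜 (cgGrad T (cgIter T y x₀ k)) (cgGrad T (cgIter T y x₀ i)) = 0
  image_dir : ∀ i < k,
    inner 𝕜 (T (cgDir T (cgIter T y x₀ k))) (T (cgDir T (cgIter T y x₀ i))) = 0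
  grad_dir_self : inner 𝕜 (cgGrad T (cgIter T y x₀ k)) (cgDir T (cgIter T y x₀ k)) =
    ((‖cgGrad T (cgIter T y x₀ k)‖ ^ 2 : ℝ) : 𝕜)

/-! ### Orthogonality of gradients and conjugacy of directions. -/

section Orthogonality

variable {T : E →L[𝕜] Y} {y : Y} {x₀ : E}

theorem CGOrthogonal.cgGrad_eq_zero {k : ℕ} (h : CGOrthogonal T y x₀ k)
    (hu : T (cgDir T (cgIter T y x₀ k)) = 0) : cgGrad T (cgIter T y x₀ k) = 0 := by
  have h1 := h.grad_dir_self
  rw [cgGrad, ContinuousLinearMap.adjoint_inner_left, hu, inner_zero_right, ← cgGrad] at h1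
  have h2 : ‖cgGrad T (cgIter T y x₀ k)‖ ^ 2 = 0 := by exact_mod_cast h1.symm
  simpa using h2

/-- A zero denominator does no harm: ‖g_k‖² = ⟨r_k, T d_k⟩, so the numerator vanishes with it. -/
theorem CGOrthogonal.cgAlpha_mul {k : ℕ} (h : CGOrthogonal T y x₀ k) :
    cgAlpha T (cgIter T y x₀ k) * ‖T (cgDir T (cgIter T y x₀ k))‖ ^ 2 =
      ‖cgGrad T (cgIter T y x₀ k)‖ ^ 2 := by
  by_cases hu : T (cgDir T (cgIter T y x₀ k)) = 0
  · simp [hu, h.cgGrad_eq_zero hu]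
  · rw [cgAlpha, div_mul_cancel₀]
    simpa using hu

variable (T y x₀)

theorem cgOrthogonal (k : ℕ) : CGOrthogonal T y x₀ k := by
  induction k using Nat.strong_induction_on with
  | _ k IH =>
  cases k with
  | zero =>
    refine ⟨by simp, by simp, by simp, ?_⟩
    rw [cgDir_zero, inner_self_eq_norm_sq_to_K]
    push_cast; rfl
  | succ k =>
    have hk := IH k (Nat.lt_succ_self k)
    have hgd : ∀ i < k + 1,
        inner 𝕜 (cgGrad T (cgIter T y x₀ (k + 1))) (cgDir T (cgIter T y x₀ i)) = 0 := by
      intro i hi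
      rw [cgGrad_succ, inner_sub_left, inner_smul_left, ContinuousLinearMap.adjoint_inner_left,
        RCLike.conj_ofReal]
      rcases Nat.lt_succ_iff_lt_or_eq.mp hi with hi | rfl
      · rw [hk.grad_dir i hi, hk.image_dir i hi, mul_zero, sub_zero]
      -- The step length α_k is exactly what cancels the component along d_k.
      · rw [hk.grad_dir_self, inner_self_eq_norm_sq_to_K, ← hk.cgAlpha_mul]
        push_cast; ring
    have hgg : ∀ i < k + 1,
        inner 𝕜 (cgGrad T (cgIter T y x₀ (k + 1))) (cgGrad T (cgIter T y x₀ i)) = 0 := by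
      intro i hi
      cases i with
      | zero => exact hgd 0 hi
      | succ i =>
        have h1 := hgd (i + 1) hi
        rw [cgDir_succ, inner_add_right, inner_smul_right, hgd i (by omega), mul_zero,
          add_zero] at h1
        exact h1
    refine ⟨hgd, hgg, ?_, ?_⟩
    · intro i hi
      by_cases hu : T (cgDir T (cgIter T y x₀ i)) = 0
      · rw [hu, inner_zero_right]
      have hg : cgGrad T (cgIter T y x₀ i) ≠ 0 := fun h =>
        hu (by rw [cgDir_eq_zero_of_cgGrad_eq_zero T y x₀ h, map_zero])
      have hg' : (‖cgGrad T (cgIter T y x₀ i)‖ : 𝕜) ≠ 0 := by simpa using hg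
      have hu' : (‖T (cgDir T (cgIter T y x₀ i))‖ : 𝕜) ≠ 0 := by simpa using hu
      have hα : (cgAlpha T (cgIter T y x₀ i) : 𝕜) ≠ 0 := by
        rw [cgAlpha]; push_cast
        exact div_ne_zero (pow_ne_zero _ hg') (pow_ne_zero _ hu')
      -- Since α_i T*T d_i = g_i - g_{i+1}, conjugacy reduces to orthogonality of gradients.
      have h1 : (cgAlpha T (cgIter T y x₀ i) : 𝕜) *
          inner 𝕜 (T (cgGrad T (cgIter T y x₀ (k + 1)))) (T (cgDir T (cgIter T y x₀ i))) =
          - inner 𝕜 (cgGrad T (cgIter T y x₀ (k + 1))) (cgGrad T (cgIter T y x₀ (i + 1))) := by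
        rw [cgGrad_succ T y x₀ i, inner_sub_right, hgg i hi, inner_smul_right,
          ContinuousLinearMap.adjoint_inner_right]
        ring
      rw [cgDir_succ, map_add, map_smul, inner_add_left, inner_smul_left, RCLike.conj_ofReal]
      rcases Nat.lt_succ_iff_lt_or_eq.mp hi with hi | rfl
      · rw [hk.image_dir i hi, mul_zero, add_zero]
        rw [hgg (i + 1) (by omega), neg_zero] at h1
        exact (mul_eq_zero.mp h1).resolve_left hα
      -- After multiplication by α_k, the choice of β_k cancels -‖g_{k+1}‖².
      · apply mul_left_cancel₀ hα
        rw [mul_add, h1, mul_zero, inner_self_eq_norm_sq_to_K, inner_self_eq_norm_sq_to_K,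
          cgBeta_eq, cgAlpha]
        push_cast
        field_simp
        ring
    · rw [cgDir_succ, inner_add_right, inner_smul_right, hgd k (Nat.lt_succ_self k),
        inner_self_eq_norm_sq_to_K]
      push_cast; ring

/-- Going down from j = n, r_i and r_{i+1} differ by a multiple of T d_i, and ⟨r_n, T d_i⟩ = ⟨g_n,
d_i⟩ = 0. -/
theorem inner_cgIter_r {n j : ℕ} (h : j ≤ n) :
    inner 𝕜 (cgIter T y x₀ n).r (cgIter T y x₀ j).r = ((‖(cgIter T y x₀ n).r‖ ^ 2 : ℝ) : 𝕜) := by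
  induction h using Nat.decreasingInduction with
  | self => rw [inner_self_eq_norm_sq_to_K]; push_cast; rfl
  | of_succ i hi ih =>
    have h1 := (cgOrthogonal T y x₀ n).grad_dir i hi
    rw [cgGrad, ContinuousLinearMap.adjoint_inner_left] at h1
    rw [cgIter_r_succ, inner_sub_right, inner_smul_right, h1, mul_zero, sub_zero] at ih
    exact ih

theorem norm_cgIter_r_sub_sq {n j : ℕ} (h : j ≤ n) :
    ‖(cgIter T y x₀ j).r - (cgIter T y x₀ n).r‖ ^ 2 =
      ‖(cgIter T y x₀ j).r‖ ^ 2 - ‖(cgIter T y x₀ n).r‖ ^ 2 := by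
  rw [norm_sub_rev, @norm_sub_sq 𝕜, inner_cgIter_r T y x₀ h, RCLike.ofReal_re]
  ring

end Orthogonality

/-- A sequence whose squared increments are dominated by the decrease of a nonnegative sequence
is a Cauchy sequence. -/
theorem cauchySeq_of_norm_sub_sq_le {F : Type*} [NormedAddCommGroup F] {u : ℕ → F} {a : ℕ → ℝ}
    (ha : ∀ n, 0 ≤ a n) (h : ∀ m n, m ≤ n → ‖u m - u n‖ ^ 2 ≤ a m - a n) : CauchySeq u := by
  have hanti : Antitone a := fun m n hmn => by
    have := h m n hmn
    nlinarith [sq_nonneg ‖u m - u n‖]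
  have hlim := tendsto_atTop_ciInf hanti ⟨0, by rintro _ ⟨n, rfl⟩; exact ha n⟩
  rw [Metric.cauchySeq_iff']
  intro ε hε
  obtain ⟨K, hK⟩ := Metric.cauchySeq_iff'.mp hlim.cauchySeq (ε ^ 2) (by positivity)
  refine ⟨K, fun n hn => ?_⟩
  have h1 := h K n hn
  have h2 := hK n hn
  rw [Real.dist_eq, abs_sub_comm] at h2
  rw [dist_comm, dist_eq_norm]
  exact lt_of_pow_lt_pow_left₀ 2 hε.le (h1.trans_lt ((le_abs_self _).trans_lt h2))

/-! ### Norm convergence of residuals and iterates. -/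

section Convergence

variable (T : E →L[𝕜] Y) (y : Y) (x₀ : E)

/-- The CGNE residuals converge, and their limit `r` is a least-squares residual of `y`. -/
theorem exists_tendsto_cgIter_r : ∃ r : Y,
    Tendsto (fun k => (cgIter T y x₀ k).r) atTop (𝓝 r) ∧ adjoint T r = 0 ∧
      ‖r‖ ^ 2 = RCLike.re (inner 𝕜 r y) := by
  obtain ⟨r, hr⟩ := cauchySeq_tendsto_of_complete
    (cauchySeq_of_norm_sub_sq_le (u := fun k => (cgIter T y x₀ k).r)
      (a := fun k => ‖(cgIter T y x₀ k).r‖ ^ 2) (fun _ => by positivity)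
      (fun m n h => (norm_cgIter_r_sub_sq T y x₀ h).le))
  have hg : Tendsto (fun k => cgGrad T (cgIter T y x₀ k)) atTop (𝓝 (adjoint T r)) :=
    ((adjoint T).continuous.tendsto r).comp hr
  -- Consecutive gradients are orthogonal and share the limit T* r, so ‖T* r‖² = 0.
  have hlim : adjoint T r = 0 := by
    have h1 : Tendsto (fun k => inner 𝕜 (cgGrad T (cgIter T y x₀ (k + 1)))
        (cgGrad T (cgIter T y x₀ k))) atTop (𝓝 (inner 𝕜 (adjoint T r) (adjoint T r))) :=
      ((tendsto_add_atTop_iff_nat 1).mpr hg).inner hg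
    simp only [(cgOrthogonal T y x₀ (_ + 1)).grad_grad _ (Nat.lt_succ_self _)] at h1
    exact inner_self_eq_zero.mp (tendsto_nhds_unique h1 tendsto_const_nhds)
  refine ⟨r, hr, hlim, ?_⟩
  have h2 : Tendsto (fun k => inner 𝕜 r (cgIter T y x₀ k).r) atTop (𝓝 (inner 𝕜 r r)) :=
    tendsto_const_nhds.inner hr
  have h3 : ∀ k, inner 𝕜 r (cgIter T y x₀ k).r = inner 𝕜 r y := fun k => by
    rw [cgIter_r_eq, inner_sub_right, ← ContinuousLinearMap.adjoint_inner_left, hlim,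
      inner_zero_left, sub_zero]
  simp only [h3] at h2
  rw [← tendsto_nhds_unique h2 tendsto_const_nhds, inner_self_eq_norm_sq]

/-- w_i is a combination of r_0, …, r_i with nonnegative coefficients, and each ⟨r_n, r_j⟩ equals
‖r_n‖². -/
theorem re_inner_cgIter_r_w_nonneg {n i : ℕ} (h : i ≤ n) :
    0 ≤ RCLike.re (inner 𝕜 (cgIter T y x₀ n).r (cgIter T y x₀ i).w) := by
  induction i with
  | zero =>
    have : (cgIter T y x₀ 0).w = (cgIter T y x₀ 0).r := rfl
    rw [this, inner_cgIter_r T y x₀ h, RCLike.ofReal_re]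
    positivity
  | succ i ih =>
    rw [cgIter_w_succ, inner_add_right, inner_smul_right, map_add, RCLike.re_ofReal_mul,
      inner_cgIter_r T y x₀ h, RCLike.ofReal_re]
    have hβ : 0 ≤ cgBeta T (cgIter T y x₀ i) := by rw [cgBeta]; positivity
    have := mul_nonneg hβ (ih (by omega))
    positivity

/-- The error with respect to a solution `z` decreases at least by the squared increment. -/
theorem norm_cgIter_x_sub_sq_le {z : E} (hz : T z = y) {m n : ℕ} (h : m ≤ n) :
    ‖(cgIter T y x₀ m).x - (cgIter T y x₀ n).x‖ ^ 2 ≤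
      ‖z - (cgIter T y x₀ m).x‖ ^ 2 - ‖z - (cgIter T y x₀ n).x‖ ^ 2 := by
  -- Each increment contributes α_i ⟨z - x_n, T* w_i⟩ = α_i ⟨r_n, w_i⟩, with nonnegative real part.
  have key : 0 ≤ RCLike.re (inner 𝕜 (z - (cgIter T y x₀ n).x)
      ((cgIter T y x₀ n).x - (cgIter T y x₀ m).x)) := by
    induction h using Nat.decreasingInduction with
    | self => simp
    | of_succ i hi ih =>
      have h1 : 0 ≤ RCLike.re (inner 𝕜 (z - (cgIter T y x₀ n).x)
          ((cgIter T y x₀ (i + 1)).x - (cgIter T y x₀ i).x)) := by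
        rw [cgIter_x_succ, add_sub_cancel_left, inner_smul_right, RCLike.re_ofReal_mul, cgDir,
          ContinuousLinearMap.adjoint_inner_right, map_sub, hz, ← cgIter_r_eq]
        refine mul_nonneg ?_ (re_inner_cgIter_r_w_nonneg T y x₀ hi.le)
        rw [cgAlpha]; positivity
      have h2 := add_nonneg ih h1
      rw [← map_add, ← inner_add_right, sub_add_sub_cancel] at h2
      exact h2
  have h3 : z - (cgIter T y x₀ m).x =
      (z - (cgIter T y x₀ n).x) + ((cgIter T y x₀ n).x - (cgIter T y x₀ m).x) := by abel
  rw [h3, @norm_add_sq 𝕜, norm_sub_rev (cgIter T y x₀ m).x]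
  linarith

/-- If the equation is solvable, then the CGNE iterates converge in norm to a solution. -/
theorem exists_tendsto_cgIter_x {z : E} (hz : T z = y) : ∃ x : E, T x = y ∧
    Tendsto (fun k => (cgIter T y x₀ k).x) atTop (𝓝 x) := by
  obtain ⟨x, hx⟩ := cauchySeq_tendsto_of_complete
    (cauchySeq_of_norm_sub_sq_le (u := fun k => (cgIter T y x₀ k).x)
      (a := fun k => ‖z - (cgIter T y x₀ k).x‖ ^ 2) (fun _ => by positivity)
      (fun m n h => norm_cgIter_x_sub_sq_le T y x₀ hz h))
  obtain ⟨r, hr, hadj, hnorm⟩ := exists_tendsto_cgIter_r T y x₀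
  have hr0 : r = 0 := by
    rw [← hz, ← ContinuousLinearMap.adjoint_inner_left, hadj, inner_zero_left, map_zero] at hnorm
    simpa using hnorm
  have h1 : Tendsto (fun k => (cgIter T y x₀ k).r) atTop (𝓝 (y - T x)) := by
    simp only [cgIter_r_eq]
    exact tendsto_const_nhds.sub ((T.continuous.tendsto x).comp hx)
  refine ⟨x, ?_, hx⟩
  have h2 := tendsto_nhds_unique h1 hr
  rw [hr0, sub_eq_zero] at h2
  exact h2.symm

end Convergence

end CGNE

/-! ### Residual estimate across levels. -/

namespace LevelFamily

variable {𝕜 X Y : Type*} [RCLike 𝕜]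
  [NormedAddCommGroup X] [InnerProductSpace 𝕜 X] [CompleteSpace X]
  [NormedAddCommGroup Y] [InnerProductSpace 𝕜 Y] [CompleteSpace Y]

theorem T_incl (L : LevelFamily 𝕜 X Y) {M N : ℕ} (h : M ≤ N) (x : L.V M) :
    L.T N (L.incl h x) = L.T M x :=
  L.compat M N h x

theorem P_eq_self (L : LevelFamily 𝕜 X Y) {N : ℕ} {x : X} (hx : x ∈ L.V N) : L.P N x = x :=
  Submodule.starProjection_eq_self_iff.mpr hx

theorem norm_P_sub_le (L : LevelFamily 𝕜 X Y) (N : ℕ) (x : X) {v : X} (hv : v ∈ L.V N) :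
    ‖L.P N x - x‖ ≤ ‖v - x‖ := by
  rw [norm_sub_rev, norm_sub_rev v, P, Submodule.starProjection_minimal]
  exact ciInf_le ⟨0, by rintro _ ⟨w, rfl⟩; exact norm_nonneg _⟩ (⟨v, hv⟩ : L.V N)

/-- A least-squares residual at level `N` is controlled by the distance of a solution to that
level. -/
theorem norm_sq_le_of_adjoint_eq_zero (L : LevelFamily 𝕜 X Y) {M : ℕ} {z : L.V M} {y : Y}
    (hz : L.T M z = y) {N : ℕ} {r : Y} (hadj : ContinuousLinearMap.adjoint (L.T N) r = 0)
    (hr : ‖r‖ ^ 2 = RCLike.re (inner 𝕜 r y)) :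
    ‖r‖ ^ 2 ≤ ‖L.P N (z : X) - z‖ * ‖y‖ := by
  have hry : ‖r‖ ≤ ‖y‖ := by
    have h1 : ‖r‖ ^ 2 ≤ ‖r‖ * ‖y‖ := hr.le.trans (re_inner_le_norm r y)
    by_contra! h
    nlinarith [norm_nonneg y]
  let q : L.V N := ⟨L.P N (z : X), Submodule.starProjection_apply_mem _ _⟩
  have hM := le_max_right N M
  have hN := le_max_left N M
  -- r is orthogonal to the range of T_N, so T_N P_N z may be subtracted from y = T_M z; both terms
  -- live at level max N M.
  have h2 : inner 𝕜 r y = inner 𝕜 r (L.T (max N M) (L.incl hM z - L.incl hN q)) := by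
    rw [map_sub, T_incl, T_incl, hz, inner_sub_right,
      ← ContinuousLinearMap.adjoint_inner_left (L.T N), hadj, inner_zero_left, sub_zero]
  have h3 : ‖L.T (max N M) (L.incl hM z - L.incl hN q)‖ ≤ ‖L.P N (z : X) - z‖ := by
    refine ((L.T (max N M)).le_of_opNorm_le (L.norm_le _) _).trans ?_
    rw [one_mul, norm_sub_rev]
    rfl
  rw [hr, h2]
  refine (re_inner_le_norm _ _).trans ?_
  rw [mul_comm]
  exact mul_le_mul h3 hry (norm_nonneg _) (norm_nonneg _)

end LevelFamily

/-! ### The multi-level algorithm with exact data. -/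

namespace MLParams

variable {𝕜 X Y : Type*} [RCLike 𝕜]
  [NormedAddCommGroup X] [InnerProductSpace 𝕜 X] [CompleteSpace X]
  [NormedAddCommGroup Y] [InnerProductSpace 𝕜 Y] [CompleteSpace Y]
  {p : MLParams X Y} {L : LevelFamily 𝕜 X Y}

theorem resSq_le_zero_iff {N : ℕ} {x : L.V N} : p.resSq L N x ≤ 0 ↔ L.T N x = p.yδ := by
  rw [← sub_eq_zero, ← norm_eq_zero, resSq]
  exact ⟨fun h => pow_eq_zero_iff two_ne_zero |>.mp (le_antisymm h (by positivity)),
    fun h => by simp [h]⟩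

theorem resSq_incl {M N : ℕ} (h : M ≤ N) (x : L.V M) :
    p.resSq L N (L.incl h x) = p.resSq L M x := by
  rw [resSq, resSq, L.T_incl]

theorem resSq_cg (N : ℕ) (x₀ : L.V N) (k : ℕ) :
    p.resSq L N (p.cg L N x₀ k).x = ‖(p.cg L N x₀ k).r‖ ^ 2 := by
  rw [resSq, cg, cgIter_r_eq, norm_sub_rev]

theorem stopTol_eq_zero (hδ : p.δ = 0) : p.stopTol = 0 := by simp [stopTol, hδ]

theorem levelTol_succ_le (hη : 0 < p.η) (N : ℕ) : p.levelTol L (N + 1) ≤ p.levelTol L N := by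
  have := L.norm_P_sub_le (N + 1) p.xs (v := L.P N p.xs)
    (L.mono N.le_succ (Submodule.starProjection_apply_mem _ _))
  rw [levelTol, levelTol]
  gcongr

theorem levelTol_eq_zero (hδ : p.δ = 0) {N : ℕ} (h : L.P N p.xs = p.xs) :
    p.levelTol L N = 0 := by
  simp [levelTol, hδ, h]

section Exact

variable {M : ℕ} {z : L.V M}

/-- A zero gradient would make r_k a least-squares residual, hence ‖r_k‖² ≤ ε_N. -/
theorem cgGrad_ne_zero (hδ : p.δ = 0) (hη : 0 < p.η) (hxs : p.xs = z) (hz : L.T M z = p.yδ)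
    {N : ℕ} {x₀ : L.V N} {k : ℕ} (h : p.levelTol L N < p.resSq L N (p.cg L N x₀ k).x) :
    cgGrad (L.T N) (p.cg L N x₀ k) ≠ 0 := by
  intro h0
  rw [cgGrad] at h0
  have h1 := L.norm_sq_le_of_adjoint_eq_zero hz h0 (by
    have h2 : inner 𝕜 (p.cg L N x₀ k).r (p.cg L N x₀ k).r = inner 𝕜 (p.cg L N x₀ k).r p.yδ := by
      have h3 : (p.cg L N x₀ k).r = p.yδ - L.T N (p.cg L N x₀ k).x := cgIter_r_eq _ _ _ _
      nth_rewrite 2 [h3]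
      rw [inner_sub_right, ← ContinuousLinearMap.adjoint_inner_left, h0,
        inner_zero_left, sub_zero]
    rw [← h2, inner_self_eq_norm_sq])
  rw [resSq_cg, levelTol, hδ, hxs] at h
  have h3 : 0 ≤ ‖L.P N (z : X) - z‖ * ‖p.yδ‖ := by positivity
  nlinarith

theorem cgDir_image_ne_zero {N : ℕ} {x₀ : L.V N} {k : ℕ}
    (h : cgGrad (L.T N) (p.cg L N x₀ k) ≠ 0) : L.T N (cgDir (L.T N) (p.cg L N x₀ k)) ≠ 0 :=
  fun h0 => h ((cgOrthogonal (L.T N) p.yδ x₀ k).cgGrad_eq_zero h0)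

/-- If the threshold of a level is never met, then the level contains the exact solution or the
data vanish. -/
theorem norm_P_sub_mul_eq_zero_of_forall_lt (hδ : p.δ = 0) (hη : 0 < p.η) (hxs : p.xs = z)
    (hz : L.T M z = p.yδ) {N : ℕ} {x₀ : L.V N}
    (h : ∀ k, p.levelTol L N < p.resSq L N (p.cg L N x₀ k).x) :
    ‖L.P N p.xs - p.xs‖ * ‖p.yδ‖ = 0 := by
  obtain ⟨r, hr, hadj, hnorm⟩ := exists_tendsto_cgIter_r (L.T N) p.yδ x₀
  have h1 := L.norm_sq_le_of_adjoint_eq_zero hz hadj hnorm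
  -- With a the product in the goal, 2(1+η)a ≤ ‖r‖² ≤ a forces a = 0.
  have h2 : p.levelTol L N ≤ ‖r‖ ^ 2 :=
    ge_of_tendsto' (hr.norm.pow 2) fun k => (resSq_cg N x₀ k ▸ h k).le
  rw [← hxs] at h1
  rw [levelTol, hδ] at h2
  have h3 : 0 ≤ ‖L.P N p.xs - p.xs‖ * ‖p.yδ‖ := by positivity
  nlinarith

/-- The invariant of the multi-level algorithm started at level `J`, where `K` is a level that
contains the exact solution. -/
def Invariant (p : MLParams X Y) (L : LevelFamily 𝕜 X Y) (J K : ℕ) : MLStatus L → Prop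
  | .running N x₀ k => J ≤ N ∧ N ≤ K ∧ ∀ j ≤ k, p.levelTol L N < p.resSq L N (p.cg L N x₀ j).x
  | .done N x => N ≤ K ∧ L.T N x = p.yδ

theorem Invariant.step (hδ : p.δ = 0) (hη : 0 < p.η) {J K : ℕ} (hK : L.P K p.xs = p.xs)
    {s : MLStatus L} (h : p.Invariant L J K s) : p.Invariant L J K (p.step L s) := by
  cases s with
  | done N x => exact h
  | running N x₀ k =>
    obtain ⟨hJ, hN, hlt⟩ := h
    rw [MLParams.step, stopTol_eq_zero hδ]
    split_ifs with h1 h2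
    · rw [resSq_incl] at h2
      exact ⟨hN, resSq_le_zero_iff.mp h2⟩
    · rw [resSq_incl] at h2
      refine ⟨by omega, Nat.succ_le_of_lt (lt_of_le_of_ne hN ?_), fun j hj => ?_⟩
      -- At level K the threshold is 0, so meeting it would already satisfy the global test.
      · rintro rfl
        exact h2 (levelTol_eq_zero hδ hK ▸ h1)
      -- The next level starts from x_k, not x_{k+1}: its residual still exceeds ε_N ≥ ε_{N+1}.
      · obtain rfl : j = 0 := by omega
        refine (levelTol_succ_le hη N).trans_lt ((hlt k le_rfl).trans_eq ?_)
        exact (resSq_incl N.le_succ _).symm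
    · refine ⟨hJ, hN, fun j hj => ?_⟩
      rcases Nat.le_succ_iff.mp hj with hj | rfl
      · exact hlt j hj
      · exact not_le.mp h1

theorem invariant_init (hδ : p.δ = 0) {x₀₀ : L.V 0} {J K : ℕ} (hJK : J ≤ K)
    (hJ : p.stopTol < p.resSq L 0 x₀₀ → p.IsStartLevel L x₀₀ J) :
    p.Invariant L J K (p.init L x₀₀ J) := by
  rw [init]
  split_ifs with h
  · rw [stopTol_eq_zero hδ] at h
    exact ⟨K.zero_le, resSq_le_zero_iff.mp h⟩
  · refine ⟨le_rfl, hJK, fun j hj => ?_⟩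
    obtain rfl : j = 0 := by omega
    exact (hJ (not_le.mp h)).1

theorem run_succ (x₀₀ : L.V 0) (J n : ℕ) :
    p.run L x₀₀ J (n + 1) = p.step L (p.run L x₀₀ J n) := by
  simp only [run, Function.iterate_succ_apply']

theorem invariant_run (hδ : p.δ = 0) (hη : 0 < p.η) {x₀₀ : L.V 0} {J K : ℕ} (hJK : J ≤ K)
    (hK : L.P K p.xs = p.xs) (hJ : p.stopTol < p.resSq L 0 x₀₀ → p.IsStartLevel L x₀₀ J)
    (n : ℕ) : p.Invariant L J K (p.run L x₀₀ J n) := by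
  induction n with
  | zero => exact invariant_init hδ hJK hJ
  | succ n ih => rw [run_succ]; exact ih.step hδ hη hK

theorem run_eq_done_of_le {x₀₀ : L.V 0} {J n N : ℕ} {x : L.V N}
    (h : p.run L x₀₀ J n = .done N x) {m : ℕ} (hm : n ≤ m) : p.run L x₀₀ J m = .done N x := by
  induction m, hm using Nat.le_induction with
  | base => exact h
  | succ m _ ih => rw [run_succ, ih]; rfl

/-- A run whose levels are bounded terminates or stays at one level forever. -/
theorem done_or_stationary {x₀₀ : L.V 0} {J K : ℕ}
    (hinv : ∀ n, p.Invariant L J K (p.run L x₀₀ J n)) {n₀ N : ℕ} {x₀ : L.V N}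
    (h0 : p.run L x₀₀ J n₀ = .running N x₀ 0) :
    (∃ (n N : ℕ) (x : L.V N), p.run L x₀₀ J n = .done N x) ∨
      ∃ (n₀ N : ℕ) (x₀ : L.V N), ∀ k, p.run L x₀₀ J (n₀ + k) = .running N x₀ k := by
  -- Each change of level raises N, which the invariant bounds by K.
  induction hd : K - N using Nat.strong_induction_on generalizing n₀ N x₀ with
  | _ d IH =>
  by_cases hall : ∀ k, p.run L x₀₀ J (n₀ + k) = .running N x₀ k
  · exact .inr ⟨n₀, N, x₀, hall⟩
  have hex : ∃ k, p.run L x₀₀ J (n₀ + k) = .running N x₀ k ∧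
      p.run L x₀₀ J (n₀ + (k + 1)) ≠ .running N x₀ (k + 1) := by
    by_contra! hcon
    exact hall fun k => Nat.rec h0 (fun k ih => hcon k ih) k
  obtain ⟨k, hk, hk'⟩ := hex
  have hstep := run_succ (p := p) x₀₀ J (n₀ + k)
  rw [hk, MLParams.step] at hstep
  split_ifs at hstep with h1 h2
  · exact .inl ⟨_, _, _, hstep⟩
  · have hi := hinv (n₀ + k + 1)
    rw [hstep] at hi
    exact IH (K - (N + 1)) (by have := hi.2.1; omega) hstep rfl
  · exact absurd hstep hk'

end Exact

end MLParams

/-! ### Assembly of the theorem. -/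

theorem theorem2p6 {𝕜 X Y : Type*} [RCLike 𝕜]
    [NormedAddCommGroup X] [InnerProductSpace 𝕜 X] [CompleteSpace X]
    [NormedAddCommGroup Y] [InnerProductSpace 𝕜 Y] [CompleteSpace Y]
    (L : LevelFamily 𝕜 X Y) (y : Y) (η τ : ℝ) (hη : 0 < η) (hτ : 1 < τ)
    (Nstar : ℕ) (xstar : L.V Nstar) (hsol : L.T Nstar xstar = y)
    (p : MLParams X Y) (hp : p = { yδ := y, δ := 0, η := η, τ := τ, xs := (xstar : X) })
    (x₀₀ : L.V 0) :
    -- unless the initial guess is accepted, there is a level at which the algorithm can begin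
    (p.stopTol < p.resSq L 0 x₀₀ → ∃ J, p.IsStartLevel L x₀₀ J) ∧
    -- every run of the algorithm
    ∀ J : ℕ, (p.stopTol < p.resSq L 0 x₀₀ → p.IsStartLevel L x₀₀ J) →
      -- performs only CGNE steps whose denominators do not vanish,
      (∀ (n N : ℕ) (x₀ : L.V N) (k : ℕ), p.run L x₀₀ J n = .running N x₀ k →
        ‖cgGrad (L.T N) (p.cg L N x₀ k)‖ ^ 2 ≠ 0 ∧
          ‖L.T N (cgDir (L.T N) (p.cg L N x₀ k))‖ ^ 2 ≠ 0) ∧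
      -- and converges to a solution, in finitely many steps or by an infinite iteration at one level
      ∃ Nhat : ℕ, IsLeast {N | J ≤ N ∧ L.P N (xstar : X) = xstar} Nhat ∧
        ∃ N ≤ Nhat, ∃ xhat : L.V N, L.T N xhat = y ∧
          Tendsto (fun n => p.current L (p.run L x₀₀ J n)) atTop (𝓝 (xhat : X)) ∧
          ((∃ n, p.run L x₀₀ J n = .done N xhat) ∨
            ((y ≠ 0 → N = Nhat) ∧
              ∃ (n₀ : ℕ) (x₀ : L.V N), ∀ k, p.run L x₀₀ J (n₀ + k) = .running N x₀ k)) := by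
  have hδ : p.δ = 0 := by rw [hp]
  have hpη : 0 < p.η := by rw [hp]; exact hη
  have hxs : p.xs = xstar := by rw [hp]
  have hy : p.yδ = y := by rw [hp]
  clear hp
  subst hy
  refine ⟨fun hpos => ?_, fun J hJ => ?_⟩
  · by_cases h0 : p.levelTol L 0 < p.resSq L 0 x₀₀
    · exact ⟨0, h0, fun _ => rfl⟩
    -- The residual of `x₀₀` is the same at every level, while the threshold at `Nstar` is 0.
    · refine ⟨Nstar, ?_, fun h => absurd h h0⟩
      rw [MLParams.resSq_incl, MLParams.levelTol_eq_zero hδ (hxs ▸ L.P_eq_self xstar.2)]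
      rwa [MLParams.stopTol_eq_zero hδ] at hpos
  have hne : {N | J ≤ N ∧ L.P N (xstar : X) = xstar}.Nonempty :=
    ⟨max J Nstar, le_max_left _ _, L.P_eq_self (L.mono (le_max_right _ _) xstar.2)⟩
  obtain ⟨K, hK⟩ : ∃ K, IsLeast {N | J ≤ N ∧ L.P N (xstar : X) = xstar} K :=
    ⟨sInf _, Nat.sInf_mem hne, fun _ h => Nat.sInf_le h⟩
  have hPK : L.P K p.xs = p.xs := by rw [hxs]; exact hK.1.2
  have hinv := MLParams.invariant_run hδ hpη hK.1.1 hPK hJ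
  refine ⟨fun n N x₀ k hn => ?_, K, hK, ?_⟩
  · have hi := hinv n
    rw [hn] at hi
    have hg := MLParams.cgGrad_ne_zero hδ hpη hxs hsol (hi.2.2 k le_rfl)
    exact ⟨by simpa using hg, by simpa using MLParams.cgDir_image_ne_zero hg⟩
  have hcases : (∃ (n N : ℕ) (x : L.V N), p.run L x₀₀ J n = .done N x) ∨
      ∃ (n₀ N : ℕ) (x₀ : L.V N), ∀ k, p.run L x₀₀ J (n₀ + k) = .running N x₀ k := by
    by_cases h : p.resSq L 0 x₀₀ ≤ p.stopTol
    · exact .inl ⟨0, 0, x₀₀, if_pos h⟩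
    · exact MLParams.done_or_stationary hinv (n₀ := 0) (if_neg h)
  rcases hcases with ⟨n, N, x, hn⟩ | ⟨n₀, N, x₀, hrun⟩
  · have hi := hinv n
    rw [hn] at hi
    refine ⟨N, hi.1, x, hi.2, ?_, .inl ⟨n, hn⟩⟩
    refine tendsto_const_nhds.congr' ?_
    filter_upwards [eventually_ge_atTop n] with m hm
    rw [MLParams.run_eq_done_of_le hn hm]
    rfl
  · have hi : ∀ k, p.Invariant L J K (.running N x₀ k) := fun k => hrun k ▸ hinv (n₀ + k)
    have hzero := MLParams.norm_P_sub_mul_eq_zero_of_forall_lt hδ hpη hxs hsol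
      fun k => (hi k).2.2 k le_rfl
    have hNK : p.yδ ≠ 0 → N = K := fun hy => by
      refine le_antisymm (hi 0).2.1 (hK.2 ⟨(hi 0).1, ?_⟩)
      rw [← hxs, ← sub_eq_zero, ← norm_eq_zero]
      exact (mul_eq_zero.mp hzero).resolve_right (by simpa using hy)
    -- For zero data all thresholds vanish and the run may stay below K, where 0 is a solution;
    -- otherwise N = K contains `xstar`.
    obtain ⟨z, hz⟩ : ∃ z : L.V N, L.T N z = p.yδ := by
      by_cases hy : p.yδ = 0
      · exact ⟨0, by rw [map_zero, hy]⟩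
      · obtain rfl := hNK hy
        have hmem : (xstar : X) ∈ L.V N := Submodule.starProjection_eq_self_iff.mp hK.1.2
        refine ⟨⟨xstar, hmem⟩, ?_⟩
        rw [← hsol, ← L.T_incl (le_max_left N Nstar), ← L.T_incl (le_max_right N Nstar)]
        rfl
    obtain ⟨xhat, hxhat, hlim⟩ := exists_tendsto_cgIter_x (L.T N) p.yδ x₀ hz
    refine ⟨N, (hi 0).2.1, xhat, hxhat, ?_, .inr ⟨hNK, n₀, x₀, hrun⟩⟩
    rw [← tendsto_add_atTop_iff_nat n₀]
    simp only [add_comm _ n₀, hrun]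
    exact (continuous_subtype_val.tendsto xhat).comp hlim
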